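/- Let $E$ be a (real or complex) Banach space, let $r>0$, $B_E(0,r)=\{v\in E:\|v\|_E<r\}$, and let $\Phi:B_E(0,r)\to E$ be a mapping. Let $F\subset E$ be a linear subspace which, equipped with its own norm $\|\cdot\|_F$, is a reflexive Banach space, and suppose that $\|v\|_E\le c\,\|v\|_F$ for all $v\in F$ and some constant $c>0$. Assume that (a1) $\Phi(v)-v\in F$ for every $v\in B_E(0,r)$, and $\|\Phi(v)-v\|_F=o(\|v\|_E)$ as $\|v\|_E\to 0$; (a2) $\Phi$ is continuous in the weak $F$-topology in the following sense: for every $v\in B_E(0,r)$ and every sequence $(v_s)$ in $B_E(0,r)$ with $v_s-v\in F$ for all $s$, if $v_s-v\to 0$ weakly in $F$, then $\Phi(v_s)-\Phi(v)\in F$ for all $s$ and $\Phi(v_s)-\Phi(v)\to 0$ weakly in $F$. Then $\Phi$ is a local surjection at $0$: there exists $\delta>0$ such that $\Phi(B_E(0,r))\supset B_E(0,\delta)$. -/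

import Mathlib

open Filter Topology Asymptotics

/-- A normed space over `𝕜` is reflexive if the canonical map into its bidual is onto. -/
def IsReflexiveSpace (𝕜 F : Type*) [RCLike 𝕜] [NormedAddCommGroup F] [NormedSpace 𝕜 F] : Prop :=
  Function.Surjective (NormedSpace.inclusionInDoubleDual 𝕜 F)

/-- Regard `F` as a subspace of `E` by means of the injective linear map `ι`. A sequence `x` in `E`
tends to `0` weakly in `F` if all its terms lie in `F` and, as a sequence of elements of `F`,
it converges to `0` in the weak topology of `F`. -/
def TendstoZeroWeaklyIn {𝕜 E F : Type*} [RCLike 𝕜] [NormedAddCommGroup E] [NormedSpace 𝕜 E]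
    [NormedAddCommGroup F] [NormedSpace 𝕜 F] (ι : F →ₗ[𝕜] E) (x : ℕ → E) : Prop :=
  ∃ u : ℕ → F, (∀ s, ι (u s) = x s) ∧
    Tendsto (fun s => toWeakSpace 𝕜 F (u s)) atTop (𝓝 (toWeakSpace 𝕜 F 0))

/-!
Given `y` near `0`, one looks for a solution of `Φ v = y` of the form `v = y + ι w` with `w` in a
closed ball of `F`. Writing `Φ v = v + ι (R v)`, this is the fixed point equation
`w = -R (y + ι w)`. The estimate `R v = o(v)` makes the right-hand side a self-map of a small closed
ball of `F`, and the weak continuity of `Φ` makes it weakly sequentially continuous there. As `F` is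
reflexive, that ball is weakly compact, so `exists_fixed_point_of_weakly_seqContinuous` applies.

The fixed point theorem deals only with sequences, so the map is first restricted to a separable
closed convex invariant subset (`exists_isSeparable_mapsTo`). There countably many functionals
separate points, weak compactness becomes sequential, and it is enough to find points `x` for which
finitely many functionals almost agree at `x` and `T x`. Such points come from Brouwer's theorem
applied to barycentric coordinates with respect to a finite net (`exists_norm_map_sub_map_le`).

Brouwer's theorem is proved on the standard simplex through Scarf's lemma
(`exists_dominant_image_eq_univ`), a parity argument on finitely many points with several rankings
that replaces the triangulations of Sperner's lemma.
-/

/-! ### Scarf's lemma -/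

section Scarf

variable {X I α : Type*} [LinearOrder α]

/-- Given a family `r i` of rankings of `X`, a set `S` is dominant if no point of `X` lies strictly
above the `r i`-minimum of `S` for all `i` simultaneously. -/
def Dominant (r : I → X → α) (S : Finset X) : Prop :=
  ∀ y, ∃ i, ∀ x ∈ S, r i y ≤ r i x

theorem Dominant.mono {r : I → X → α} {S T : Finset X} (hT : Dominant r T) (h : S ⊆ T) :
    Dominant r S := fun y =>
  (hT y).imp fun _ hi x hx => hi x (h hx)

variable [DecidableEq X] [Fintype I] [DecidableEq I]

/-- A dominant set `S` one element short of `card I` has exactly two dominant extensions by one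
point, provided that each `hfree a` leaves a candidate for the extension that frees `a`. Two indices `a ≠ b` share their minimizer in `S`; each extension arises by freeing one of
them, say `a`, and adding the `r a`-largest point above the minima for all the other indices. -/
theorem Dominant.exists_two_insert [Fintype X] {r : I → X → α}
    (hinj : ∀ i, Function.Injective (r i)) {S : Finset X} (hS : Dominant r S) (hne : S.Nonempty)
    (hcard : S.card + 1 = Fintype.card I)
    (hfree : ∀ a, ∃ y, ∀ i, i ≠ a → ∃ x ∈ S, r i x < r i y) :
    ∃ p q, p ≠ q ∧ ∀ y, (y ∉ S ∧ Dominant r (insert y S)) ↔ y = p ∨ y = q := by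
  have hmin : ∀ i, ∃ x ∈ S, ∀ x' ∈ S, r i x ≤ r i x' := fun i => S.exists_min_image (r i) hne
  choose m hmS hm using hmin
  have hsurj : ∀ x ∈ S, ∃ i, m i = x := fun x hx => by
    obtain ⟨i, hi⟩ := hS x
    exact ⟨i, hinj i (le_antisymm (hm i x hx) (hi _ (hmS i)))⟩
  -- A set of indices whose minimizers exhaust `S` misses at most one index.
  have hbig : ∀ J : Finset I, (∀ x ∈ S, ∃ i ∈ J, m i = x) → S.card ≤ J.card := fun J hJ =>
    Finset.card_le_card_of_surjOn m fun x hx => by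
      obtain ⟨i, hi, rfl⟩ := hJ x hx
      exact ⟨i, hi, rfl⟩
  obtain ⟨a, -, b, -, hab, hmab⟩ := Finset.exists_ne_map_eq_of_card_lt_of_maps_to
    (s := (Finset.univ : Finset I)) (t := S) (f := m)
    (by rw [Finset.card_univ]; omega) (fun i _ => hmS i)
  have hother : ∀ d, d = a ∨ d = b → ∀ x ∈ S, ∃ i, i ≠ d ∧ m i = x := by
    rintro d hd x hx
    obtain ⟨i, rfl⟩ := hsurj x hx
    by_cases hid : i = d
    · rcases hd with rfl | rfl
      · exact ⟨b, hab.symm, by rw [hid, hmab]⟩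
      · exact ⟨a, hab, by rw [hid, hmab]⟩
    · exact ⟨i, hid, rfl⟩
  have htop : ∀ d, ∃ y, (∀ i, i ≠ d → r i (m i) < r i y) ∧
      ∀ z, (∀ i, i ≠ d → r i (m i) < r i z) → r d z ≤ r d y := fun d => by
    classical
    obtain ⟨y, hy, hmax⟩ := Finset.exists_max_image
      (Finset.univ.filter fun y => ∀ i, i ≠ d → r i (m i) < r i y) (r d) (by
        obtain ⟨y, hy⟩ := hfree d
        refine ⟨y, Finset.mem_filter.2 ⟨Finset.mem_univ _, fun i hi => ?_⟩⟩
        obtain ⟨x, hx, hlt⟩ := hy i hi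
        exact (hm i x hx).trans_lt hlt)
    exact ⟨y, (Finset.mem_filter.1 hy).2, fun z hz =>
      hmax z (Finset.mem_filter.2 ⟨Finset.mem_univ _, hz⟩)⟩
  choose t ht htmax using htop
  have hext : ∀ d, d = a ∨ d = b → t d ∉ S ∧ Dominant r (insert (t d) S) := by
    intro d hd
    refine ⟨fun hmem => ?_, fun z => ?_⟩
    · obtain ⟨i, hi, hmi⟩ := hother d hd _ hmem
      exact (ht d i hi).ne (by rw [hmi])
    · by_cases hz : ∀ i, i ≠ d → r i (m i) < r i z
      · refine ⟨d, fun x hx => ?_⟩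
        rcases Finset.mem_insert.1 hx with rfl | hx
        · exact htmax d z hz
        · obtain ⟨i, hi⟩ := hS z
          by_cases hid : i = d
          · exact hid ▸ hi x hx
          · exact absurd (hi _ (hmS i)) (hz i hid).not_ge
      · push Not at hz
        obtain ⟨i, hid, hi⟩ := hz
        refine ⟨i, fun x hx => ?_⟩
        rcases Finset.mem_insert.1 hx with rfl | hx
        · exact hi.trans (ht d i hid).le
        · exact hi.trans (hm i x hx)
  refine ⟨t a, t b, fun heq => ?_, fun y => ⟨?_, ?_⟩⟩
  · obtain ⟨i, hi⟩ := hS (t a)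
    by_cases hia : i = a
    · exact absurd (hi _ (hmS i)) (by rw [heq]; exact (ht b i (hia ▸ hab)).not_ge)
    · exact absurd (hi _ (hmS i)) (ht a i hia).not_ge
  · rintro ⟨hyS, hy⟩
    obtain ⟨d, hd⟩ := hy y
    have hd' : ∀ x ∈ S, r d y < r d x := fun x hx =>
      lt_of_le_of_ne (hd x (Finset.mem_insert_of_mem hx)) fun h => hyS (hinj d h ▸ hx)
    -- Every point of `S` stays a minimizer after `y` is added, for an index where `y` is not below.
    have hkeep : ∀ x ∈ S, ∃ i, m i = x ∧ r i x ≤ r i y := fun x hx => by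
      obtain ⟨i, hi⟩ := hy x
      exact ⟨i, hinj i (le_antisymm (hm i x hx) (hi _ (Finset.mem_insert_of_mem (hmS i)))),
        hi y (Finset.mem_insert_self _ _)⟩
    have hdab : d = a ∨ d = b := by
      by_contra hcon
      push Not at hcon
      have := hbig ((Finset.univ.erase d).erase a) fun x hx => by
        obtain ⟨i, rfl, hi⟩ := hkeep x hx
        have hid : i ≠ d := fun h => (hd' _ hx).not_ge (h ▸ hi)
        by_cases hia : i = a
        · exact ⟨b, by simp [hab.symm, hcon.2.symm], by rw [hia, hmab]⟩
        · exact ⟨i, by simp [hia, hid], rfl⟩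
      rw [Finset.card_erase_of_mem (by simp [hcon.1.symm]),
        Finset.card_erase_of_mem (Finset.mem_univ _), Finset.card_univ] at this
      have := hne.card_pos
      omega
    have hyd : ∀ i, i ≠ d → r i (m i) < r i y := by
      intro i hid
      by_contra hcon
      have hlt : r i y < r i (m i) :=
        lt_of_le_of_ne (not_lt.1 hcon) fun h => hyS (hinj i h ▸ hmS i)
      have := hbig ((Finset.univ.erase d).erase i) fun x hx => by
        obtain ⟨j, rfl, hj⟩ := hkeep x hx
        refine ⟨j, ?_, rfl⟩
        have hjd : j ≠ d := fun h => (hd' _ hx).not_ge (h ▸ hj)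
        have hji : j ≠ i := fun h => hlt.not_ge (h ▸ hj)
        simp [hjd, hji]
      rw [Finset.card_erase_of_mem (by simp [hid]),
        Finset.card_erase_of_mem (Finset.mem_univ _), Finset.card_univ] at this
      have := hne.card_pos
      omega
    have hytd : y = t d := by
      refine hinj d (le_antisymm (htmax d y hyd) ?_)
      obtain ⟨i, hi⟩ := hy (t d)
      by_cases hid : i = d
      · exact hid ▸ hi y (Finset.mem_insert_self _ _)
      · exact absurd (hi _ (Finset.mem_insert_of_mem (hmS i))) (ht d i hid).not_ge
    rcases hdab with rfl | rfl
    · exact Or.inl hytd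
    · exact Or.inr hytd
  · rintro (rfl | rfl)
    · exact hext a (Or.inl rfl)
    · exact hext b (Or.inr rfl)

/-- If a set `S` of `card I` points does not receive all colours, then the number of points whose
removal leaves exactly the colours other than `i₀` is even: it is `0` or `2`. -/
theorem even_card_filter_image_erase {S : Finset X} (c : X → I) (i₀ : I)
    (hcard : S.card = Fintype.card I) (hS : S.image c ≠ Finset.univ) :
    Even (S.filter fun x => (S.erase x).image c = Finset.univ.erase i₀).card := by
  rcases (S.filter fun x => (S.erase x).image c = Finset.univ.erase i₀).eq_empty_or_nonempty with
    h | ⟨p, hp⟩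
  · simp [h]
  obtain ⟨hpS, hpc⟩ := Finset.mem_filter.1 hp
  have hcp : c p ≠ i₀ := fun h => hS (by
    rw [← Finset.insert_erase hpS, Finset.image_insert, hpc, h,
      Finset.insert_erase (Finset.mem_univ _)])
  obtain ⟨q, hq, hqp⟩ := Finset.mem_image.1
    (hpc ▸ Finset.mem_erase.2 ⟨hcp, Finset.mem_univ _⟩ : c p ∈ (S.erase p).image c)
  obtain ⟨hne, hqS⟩ := Finset.mem_erase.1 hq
  have : (S.filter fun x => (S.erase x).image c = Finset.univ.erase i₀) = {p, q} := by
    ext x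
    simp only [Finset.mem_filter, Finset.mem_insert, Finset.mem_singleton]
    constructor
    · rintro ⟨hxS, hxc⟩
      by_contra hcon
      push Not at hcon
      have hinj : Set.InjOn c (S.erase x) := Finset.card_image_iff.1 (by
        rw [hxc, Finset.card_erase_of_mem (Finset.mem_univ _), Finset.card_univ,
          Finset.card_erase_of_mem hxS, hcard])
      exact hne (hinj (by simp [hqS, hcon.2.symm]) (by simp [hpS, hcon.1.symm]) hqp)
    · rintro (rfl | rfl)
      · exact ⟨hpS, hpc⟩
      · refine ⟨hqS, ?_⟩
        have h1 : S.erase x = insert p ((S.erase p).erase x) := by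
          rw [Finset.erase_right_comm, Finset.insert_erase (by simp [hpS, hne.symm])]
        rw [h1, Finset.image_insert, ← hqp, ← Finset.image_insert, Finset.insert_erase hq, hpc]
  rw [this, Finset.card_pair hne.symm]
  exact even_two

/-- **Scarf's lemma**. Let the points `s i` be slack: `s i` is the bottom of the ranking `r i` and
lies above all non-slack points in the other rankings. If `s i` has colour `i`, then some dominant
set receives all colours. The proof counts, modulo two, the pairs of a dominant set of size
`card I` and a subset whose colours are exactly those different from a fixed `i₀`. -/
theorem exists_dominant_image_eq_univ [Fintype X] (r : I → X → α)
    (hinj : ∀ i, Function.Injective (r i)) (s : I → X) (hlow : ∀ i x, x ≠ s i → r i (s i) < r i x)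
    (hhigh : ∀ i j, j ≠ i → ∀ x, x ∉ Set.range s → r i x < r i (s j))
    (hne : ∃ x, x ∉ Set.range s) (c : X → I) (hc : ∀ i, c (s i) = i) :
    ∃ S : Finset X, Dominant r S ∧ S.image c = Finset.univ := by
  classical
  by_contra hcon
  push Not at hcon
  obtain ⟨x₀, hx₀⟩ := hne
  set i₀ := c x₀
  have hpos : 0 < Fintype.card I := Fintype.card_pos_iff.2 ⟨i₀⟩
  have hbot : ∀ i x, r i (s i) ≤ r i x := fun i x => by
    by_cases h : x = s i
    · rw [h]
    · exact (hlow i x h).le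
  -- Double count the pairs of a door contained in a room; doors lack one element and the colour `i₀`.
  set rooms : Finset (Finset X) :=
    Finset.univ.filter fun S => Dominant r S ∧ S.card = Fintype.card I with hrooms
  set doors : Finset (Finset X) :=
    Finset.univ.filter fun D => Dominant r D ∧ D.card + 1 = Fintype.card I ∧
      D.image c = Finset.univ.erase i₀ with hdoors
  have hdouble := Finset.sum_card_bipartiteAbove_eq_sum_card_bipartiteBelow
    (s := doors) (t := rooms) (fun D S => D ⊆ S)
  have hRHS : Even (∑ S ∈ rooms, (doors.bipartiteBelow (fun D S => D ⊆ S) S).card) := by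
    refine Finset.even_sum _ fun S hS => ?_
    obtain ⟨hSdom, hScard⟩ := (Finset.mem_filter.1 hS).2
    have : doors.bipartiteBelow (fun D S => D ⊆ S) S =
        (S.filter fun x => (S.erase x).image c = Finset.univ.erase i₀).image S.erase := by
      ext D
      simp only [Finset.mem_bipartiteBelow, hdoors, Finset.mem_filter, Finset.mem_univ, true_and,
        Finset.mem_image]
      constructor
      · rintro ⟨⟨-, hDcard, hDc⟩, hDS⟩
        obtain ⟨x, hx⟩ : ∃ x, S \ D = {x} := Finset.card_eq_one.1 (by
          rw [Finset.card_sdiff_of_subset hDS]; omega)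
        have hxS : x ∈ S \ D := hx ▸ Finset.mem_singleton_self x
        have hD : S.erase x = D := by
          rw [Finset.erase_eq, ← hx, Finset.sdiff_sdiff_eq_self hDS]
        exact ⟨x, ⟨(Finset.mem_sdiff.1 hxS).1, hD ▸ hDc⟩, hD⟩
      · rintro ⟨x, ⟨hxS, hxc⟩, rfl⟩
        refine ⟨⟨hSdom.mono (Finset.erase_subset _ _), ?_, hxc⟩, Finset.erase_subset _ _⟩
        rw [Finset.card_erase_add_one hxS, hScard]
    rw [this, Finset.card_image_of_injOn]
    · exact even_card_filter_image_erase c i₀ hScard (hcon S hSdom)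
    · intro x hx y hy hxy
      exact (Finset.erase_inj _ (Finset.mem_filter.1 hx).1).1 hxy
  -- The rooms containing a door are its dominant extensions by one point.
  have habove : ∀ D ∈ doors, (rooms.bipartiteAbove (fun D S => D ⊆ S) D).card =
      (Finset.univ.filter fun y => y ∉ D ∧ Dominant r (insert y D)).card := by
    intro D hD
    obtain ⟨-, hDcard, -⟩ := (Finset.mem_filter.1 hD).2
    have : rooms.bipartiteAbove (fun D S => D ⊆ S) D =
        (Finset.univ.filter fun y => y ∉ D ∧ Dominant r (insert y D)).image fun y => insert y D := by
      ext S
      simp only [Finset.mem_bipartiteAbove, hrooms, Finset.mem_filter, Finset.mem_univ, true_and,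
        Finset.mem_image]
      constructor
      · rintro ⟨⟨hSdom, hScard⟩, hDS⟩
        obtain ⟨y, hy, rfl⟩ := Finset.exists_eq_insert_iff.2 ⟨hDS, by omega⟩
        exact ⟨y, ⟨hy, hSdom⟩, rfl⟩
      · rintro ⟨y, ⟨hy, hdom⟩, rfl⟩
        exact ⟨⟨hdom, by rw [Finset.card_insert_of_notMem hy, hDcard]⟩, Finset.subset_insert _ _⟩
    rw [this, Finset.card_image_of_injOn]
    intro x hx y hy hxy
    exact (Finset.insert_inj (Finset.mem_filter.1 hx).2.1).1 hxy
  -- The only door made of slack points lies in one room; all the others lie in exactly two.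
  set D₀ : Finset X := (Finset.univ.erase i₀).image s with hD₀
  have hs : Function.Injective s := Function.LeftInverse.injective hc
  have hmemD₀ : ∀ x, x ∈ D₀ ↔ ∃ j, j ≠ i₀ ∧ s j = x := fun x => by simp [hD₀]
  have hcompD₀ : (Finset.univ.erase i₀).image (c ∘ s) = Finset.univ.erase i₀ := by
    rw [show c ∘ s = id from funext hc, Finset.image_id]
  have hD₀mem : D₀ ∈ doors := by
    refine Finset.mem_filter.2 ⟨Finset.mem_univ _, fun y => ?_, ?_, ?_⟩
    · by_cases hy : y ∈ Set.range s
      · obtain ⟨j, rfl⟩ := hy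
        exact ⟨j, fun x _ => hbot j x⟩
      · refine ⟨i₀, fun x hx => ?_⟩
        obtain ⟨j, hj, rfl⟩ := (hmemD₀ x).1 hx
        exact (hhigh i₀ j hj y hy).le
    · rw [hD₀, Finset.card_image_of_injective _ hs, Finset.card_erase_add_one (Finset.mem_univ _),
        Finset.card_univ]
    · rw [hD₀, Finset.image_image, hcompD₀]
  have hboundary : (rooms.bipartiteAbove (fun D S => D ⊆ S) D₀).card = 1 := by
    rw [habove D₀ hD₀mem, Finset.card_eq_one]
    obtain ⟨y₀, hy₀, hmax⟩ := (Finset.univ.filter fun x => x ∉ Set.range s).exists_max_image (r i₀)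
      ⟨x₀, Finset.mem_filter.2 ⟨Finset.mem_univ _, hx₀⟩⟩
    have hy₀s := (Finset.mem_filter.1 hy₀).2
    refine ⟨y₀, ?_⟩
    ext y
    simp only [Finset.mem_filter, Finset.mem_univ, true_and, Finset.mem_singleton]
    constructor
    · rintro ⟨hyD, hy⟩
      have hys : y ∉ Set.range s := by
        rintro ⟨j, rfl⟩
        have hj : j = i₀ := by
          by_contra h
          exact hyD ((hmemD₀ _).2 ⟨j, h, rfl⟩)
        obtain ⟨i, hi⟩ := hy x₀
        refine (hlow i x₀ fun h => hx₀ ⟨i, h.symm⟩).not_ge (hi _ ?_)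
        by_cases hii : i = i₀
        · rw [hii, hj]; exact Finset.mem_insert_self _ _
        · exact Finset.mem_insert_of_mem ((hmemD₀ _).2 ⟨i, hii, rfl⟩)
      obtain ⟨i, hi⟩ := hy y₀
      by_cases hii : i = i₀
      · subst hii
        exact hinj _ (le_antisymm (hmax y (Finset.mem_filter.2 ⟨Finset.mem_univ _, hys⟩))
          (hi y (Finset.mem_insert_self _ _)))
      · exact absurd (hi _ (Finset.mem_insert_of_mem ((hmemD₀ _).2 ⟨i, hii, rfl⟩)))
          (hlow i y₀ fun h => hy₀s ⟨i, h.symm⟩).not_ge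
    · rintro rfl
      refine ⟨fun h => ?_, fun z => ?_⟩
      · obtain ⟨j, -, hj⟩ := (hmemD₀ _).1 h
        exact hy₀s ⟨j, hj⟩
      · by_cases hz : z ∈ Set.range s
        · obtain ⟨j, rfl⟩ := hz
          exact ⟨j, fun x _ => hbot j x⟩
        · refine ⟨i₀, fun x hx => ?_⟩
          rcases Finset.mem_insert.1 hx with rfl | hx
          · exact hmax z (Finset.mem_filter.2 ⟨Finset.mem_univ _, hz⟩)
          · obtain ⟨j, hj, rfl⟩ := (hmemD₀ x).1 hx
            exact (hhigh i₀ j hj z hz).le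
  have hinterior : ∀ D ∈ doors.erase D₀,
      (rooms.bipartiteAbove (fun D S => D ⊆ S) D).card = 2 := by
    intro D hD
    obtain ⟨hDne, hDmem⟩ := Finset.mem_erase.1 hD
    obtain ⟨hDdom, hDcard, hDc⟩ := (Finset.mem_filter.1 hDmem).2
    obtain ⟨t, htD, ht⟩ : ∃ t ∈ D, t ∉ Set.range s := by
      by_contra hall
      push Not at hall
      refine hDne ?_
      rw [hD₀, ← hDc, Finset.image_image]
      have : ∀ x ∈ D, (s ∘ c) x = id x := fun x hx => by
        obtain ⟨j, rfl⟩ := hall x hx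
        simp [hc]
      rw [Finset.image_congr this, Finset.image_id]
    obtain ⟨p, q, hpq, h⟩ := hDdom.exists_two_insert hinj ⟨t, htD⟩ hDcard
      fun a => ⟨s a, fun i hi => ⟨t, htD, hhigh i a hi.symm t ht⟩⟩
    rw [habove D hDmem]
    simp only [h]
    rw [show (Finset.univ.filter fun y => y = p ∨ y = q) = {p, q} by ext; simp,
      Finset.card_pair hpq]
  rw [← hdouble, ← Finset.add_sum_erase _ _ hD₀mem, hboundary, Finset.sum_congr rfl hinterior,
    Finset.sum_const, smul_eq_mul] at hRHS
  obtain ⟨k, hk⟩ := hRHS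
  omega

end Scarf

/-! ### Brouwer's theorem on the standard simplex -/

section Brouwer

variable {ι : Type*} [Fintype ι]

/-- Approximate form of Brouwer's theorem. Scarf's lemma is applied to the grid of points of the
simplex with coordinates in `ℕ / N`, ranked by their coordinates (ties are broken by an arbitrary
enumeration), where the colour of `x` is a coordinate `i` with `x i ≤ g x i`. A dominant set has
diameter less than `card ι / N`, and lies that close to the face `x i = 0` if it contains the slack
point of `i`. -/
theorem exists_mem_stdSimplex_forall_le_add [Nonempty ι] {g : (ι → ℝ) → ι → ℝ}
    (hg : ContinuousOn g (stdSimplex ℝ ι)) (hmaps : Set.MapsTo g (stdSimplex ℝ ι) (stdSimplex ℝ ι))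
    {ε : ℝ} (hε : 0 < ε) : ∃ x ∈ stdSimplex ℝ ι, ∀ i, x i ≤ g x i + ε := by
  classical
  obtain ⟨δ, hδ, hunif⟩ := Metric.uniformContinuousOn_iff.1
    ((isCompact_stdSimplex ℝ ι).uniformContinuousOn_of_continuous hg) (ε / 2) (half_pos hε)
  set n := Fintype.card ι
  have hn : 0 < n := Fintype.card_pos
  obtain ⟨N, hN⟩ := exists_nat_gt ((n : ℝ) / min δ (ε / 2))
  have hmin : 0 < min δ (ε / 2) := lt_min hδ (half_pos hε)
  have hN0 : (0 : ℝ) < N := lt_of_le_of_lt (by positivity) hN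
  have hnN : (n : ℝ) / N < min δ (ε / 2) := by
    rw [div_lt_iff₀ hmin] at hN
    rw [div_lt_iff₀ hN0]
    linarith
  let T := {k : ι → Fin (N + 1) // ∑ i, (k i : ℕ) = N}
  let p : T → ι → ℝ := fun t i => ((t.1 i : ℕ) : ℝ) / N
  have hp : ∀ t, p t ∈ stdSimplex ℝ ι := fun t => by
    refine ⟨fun i => by positivity, ?_⟩
    simp only [p]
    rw [← Finset.sum_div, div_eq_one_iff_eq hN0.ne']
    exact_mod_cast t.2
  have hcol : ∀ t, ∃ i, p t i ≤ g (p t) i := fun t => by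
    by_contra hcon
    push Not at hcon
    have := Finset.sum_lt_sum_of_nonempty (Finset.univ_nonempty (α := ι)) fun i _ => hcon i
    rw [(hp t).2, (hmaps (hp t)).2] at this
    exact lt_irrefl _ this
  choose col hcol using hcol
  let e : T ≃ Fin (Fintype.card T) := Fintype.equivFin T
  let e' : ι ≃ Fin n := Fintype.equivFin ι
  -- Lexicographic ranks: `0` for the slack point of `i`, then `1` to `N + 1` for grid points, and
  -- `N + 2` for the other slack points; the second component breaks ties.
  let r : ι → T ⊕ ι → ℕ ×ₗ ℕ := fun i => Sum.elim (fun t => toLex ((t.1 i : ℕ) + 1, (e t : ℕ)))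
    fun j => if j = i then toLex (0, 0) else toLex (N + 2, (e' j : ℕ))
  have hrslack : ∀ i, r i (Sum.inr i) = toLex (0, 0) := fun i => by simp [r]
  have hrslack' : ∀ i j, j ≠ i → r i (Sum.inr j) = toLex (N + 2, (e' j : ℕ)) := fun i j h => by
    simp [r, h]
  have hlow : ∀ i x, x ≠ Sum.inr i → r i (Sum.inr i) < r i x := by
    rintro i (t | j) h
    · rw [hrslack]
      exact Prod.Lex.toLex_lt_toLex.2 (Or.inl (Nat.succ_pos _))
    · rw [hrslack, hrslack' i j fun h' => h (h' ▸ rfl)]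
      exact Prod.Lex.toLex_lt_toLex.2 (Or.inl (Nat.succ_pos _))
  have hhigh : ∀ i j, j ≠ i → ∀ t : T, r i (Sum.inl t) < r i (Sum.inr j) := fun i j h t => by
    rw [hrslack' i j h]
    exact Prod.Lex.toLex_lt_toLex.2 (Or.inl (Nat.succ_lt_succ (t.1 i).2))
  have hinj : ∀ i, Function.Injective (r i) := by
    rintro i (t | j) (t' | j') h
    · have h2 : (e t : ℕ) = e t' := congrArg (fun z => (ofLex z).2) h
      rw [e.injective (Fin.ext h2)]
    · by_cases hj : j' = i
      · subst hj
        exact absurd h (hlow _ _ (by simp)).ne'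
      · exact absurd h (hhigh i j' hj t).ne
    · by_cases hj : j = i
      · subst hj
        exact absurd h (hlow _ _ (by simp)).ne
      · exact absurd h (hhigh i j hj t').ne'
    · by_cases hj : j = i
      · subst hj
        by_contra hne
        exact (hlow j _ fun h' => hne h'.symm).ne h
      · by_cases hj' : j' = i
        · subst hj'
          by_contra hne
          exact (hlow j' _ hne).ne' h
        · rw [hrslack' i j hj, hrslack' i j' hj'] at h
          have h2 : (e' j : ℕ) = e' j' := congrArg (fun z => (ofLex z).2) h
          rw [e'.injective (Fin.ext h2)]
  have hgrid : ∀ m : ι → ℕ, ∑ i, (m i + 1) ≤ N → ∃ y : T, ∀ i, m i < (y.1 i : ℕ) := by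
    intro m hm
    obtain ⟨j₀⟩ := ‹Nonempty ι›
    set k : ι → ℕ := fun i => m i + 1 + if i = j₀ then N - ∑ i, (m i + 1) else 0 with hk
    have hsum : ∑ i, k i = N := by
      simp only [hk]
      rw [Finset.sum_add_distrib, Finset.sum_ite_eq' Finset.univ j₀]
      simp only [Finset.mem_univ, if_true]
      omega
    have hkN : ∀ i, k i < N + 1 := fun i =>
      Nat.lt_succ_of_le (hsum ▸ Finset.single_le_sum (fun _ _ => Nat.zero_le _) (Finset.mem_univ i))
    exact ⟨⟨fun i => ⟨k i, hkN i⟩, hsum⟩, fun i => by simp only [hk]; omega⟩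
  obtain ⟨t₁⟩ : Nonempty T := by
    obtain ⟨j₀⟩ := ‹Nonempty ι›
    exact ⟨⟨fun i => if i = j₀ then Fin.last N else 0, by
      rw [Finset.sum_eq_single j₀] <;> simp +contextual⟩⟩
  obtain ⟨S, hSdom, hSc⟩ := exists_dominant_image_eq_univ r hinj Sum.inr hlow
    (by
      rintro i j hj (t | i') hx
      · exact hhigh i j hj t
      · exact absurd ⟨i', rfl⟩ hx)
    ⟨Sum.inl t₁, by simp⟩ (Sum.elim col id) (fun _ => rfl)
  obtain ⟨t₀, ht₀⟩ : ∃ t, Sum.inl t ∈ S := by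
    by_contra hcon
    push Not at hcon
    obtain ⟨i, hi⟩ := hSdom (Sum.inl t₁)
    obtain ⟨x, hx, hxi⟩ := Finset.mem_image.1 (hSc ▸ Finset.mem_univ i : i ∈ S.image _)
    rcases x with t | j
    · exact hcon t hx
    · obtain rfl : j = i := hxi
      exact (hi _ hx).not_gt (hlow _ _ (by simp))
  -- `m i` is the least `i`-th coordinate of a point of `S`, where slack points of `i` count as `0`.
  have hm : ∀ i, ∃ m : ℕ, (∀ t, Sum.inl t ∈ S → m ≤ (t.1 i : ℕ)) ∧ (Sum.inr i ∈ S → m = 0) ∧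
      ∀ y : T, m < (y.1 i : ℕ) → ∃ x ∈ S, r i x < r i (Sum.inl y) := by
    intro i
    by_cases hi : Sum.inr i ∈ S
    · exact ⟨0, fun _ _ => Nat.zero_le _, fun _ => rfl, fun y _ => ⟨_, hi, hlow _ _ (by simp)⟩⟩
    · obtain ⟨t, ht, hmin⟩ := Finset.exists_min_image
        (Finset.univ.filter fun t : T => Sum.inl t ∈ S) (fun t => (t.1 i : ℕ)) ⟨t₀, by simpa using ht₀⟩
      refine ⟨t.1 i, fun t' ht' => hmin t' (by simpa using ht'), fun h => absurd h hi, fun y hy => ?_⟩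
      exact ⟨Sum.inl t, by simpa using ht, Prod.Lex.toLex_lt_toLex.2 (Or.inl (Nat.succ_lt_succ hy))⟩
  choose m hmle hmzero hmlt using hm
  -- Otherwise some grid point would exceed all the `m i`, against dominance.
  have hsumm : N < ∑ i, m i + n := by
    by_contra hcon
    obtain ⟨y, hy⟩ := hgrid m (by
      rw [Finset.sum_add_distrib, Finset.sum_const, Finset.card_univ, smul_eq_mul, mul_one]
      exact not_lt.1 hcon)
    obtain ⟨i, hi⟩ := hSdom (Sum.inl y)
    obtain ⟨x, hx, hlt⟩ := hmlt i y (hy i)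
    exact (hi x hx).not_gt hlt
  have hclose : ∀ t, Sum.inl t ∈ S → ∀ i, (t.1 i : ℕ) < m i + n := by
    intro t ht i
    have h1 := t.2
    rw [← Finset.add_sum_erase _ _ (Finset.mem_univ i)] at h1 hsumm
    have h2 : ∑ j ∈ Finset.univ.erase i, m j ≤ ∑ j ∈ Finset.univ.erase i, (t.1 j : ℕ) :=
      Finset.sum_le_sum fun j _ => hmle j t ht
    omega
  have hle : ∀ t, Sum.inl t ∈ S → ∀ t', Sum.inl t' ∈ S → ∀ i, p t i ≤ p t' i + n / N := by
    intro t ht t' ht' i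
    have h1 := hclose t ht i
    have h2 := hmle i t' ht'
    have h3 : ((t.1 i : ℕ) : ℝ) ≤ (t'.1 i : ℕ) + n := by exact_mod_cast (by omega)
    simp only [p]
    rw [← add_div]
    exact div_le_div_of_nonneg_right h3 hN0.le
  refine ⟨p t₀, hp t₀, fun i => ?_⟩
  have hnδ := hnN.trans_le (min_le_left _ _)
  have hnε := hnN.trans_le (min_le_right _ _)
  obtain ⟨x, hx, hxi⟩ := Finset.mem_image.1 (hSc ▸ Finset.mem_univ i : i ∈ S.image _)
  rcases x with t | j
  · obtain rfl : col t = i := hxi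
    have hd : dist (p t) (p t₀) < δ := by
      refine (dist_pi_lt_iff hδ).2 fun j => ?_
      rw [Real.dist_eq, abs_lt]
      constructor <;> linarith [hle t hx t₀ ht₀ j, hle t₀ ht₀ t hx j]
    have hgd := (dist_pi_lt_iff (half_pos hε)).1 (hunif _ (hp t) _ (hp t₀) hd) (col t)
    rw [Real.dist_eq, abs_lt] at hgd
    linarith [hle t₀ ht₀ t hx (col t), hcol t]
  · obtain rfl : j = i := hxi
    have h1 := hclose t₀ ht₀ j
    rw [hmzero j hx, zero_add] at h1
    have h2 : p t₀ j ≤ n / N := div_le_div_of_nonneg_right (by exact_mod_cast h1.le) hN0.le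
    linarith [(hmaps (hp t₀)).1 j]

/-- **Brouwer's fixed point theorem** for the standard simplex. -/
theorem exists_mem_stdSimplex_apply_eq [Nonempty ι] {g : (ι → ℝ) → ι → ℝ}
    (hg : ContinuousOn g (stdSimplex ℝ ι))
    (hmaps : Set.MapsTo g (stdSimplex ℝ ι) (stdSimplex ℝ ι)) :
    ∃ x ∈ stdSimplex ℝ ι, g x = x := by
  have happrox : ∀ k : ℕ, ∃ x ∈ stdSimplex ℝ ι, ∀ i, x i ≤ g x i + 1 / ((k : ℝ) + 1) := fun k =>
    exists_mem_stdSimplex_forall_le_add hg hmaps Nat.one_div_pos_of_nat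
  choose x hx hxle using happrox
  obtain ⟨a, ha, φ, hφ, hlim⟩ := (isCompact_stdSimplex ℝ ι).tendsto_subseq hx
  have hglim : Tendsto (fun k => g (x (φ k))) atTop (𝓝 (g a)) :=
    (hg a ha).tendsto.comp (tendsto_nhdsWithin_iff.2 ⟨hlim, Eventually.of_forall fun k => hx _⟩)
  have hle : ∀ i, a i ≤ g a i := fun i => by
    have h1 := (tendsto_pi_nhds.1 hglim i).add
      (tendsto_one_div_add_atTop_nhds_zero_nat.comp hφ.tendsto_atTop)
    rw [add_zero] at h1
    exact le_of_tendsto_of_tendsto' (tendsto_pi_nhds.1 hlim i) h1 fun k => hxle (φ k) i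
  refine ⟨a, ha, funext fun i => ?_⟩
  exact ((Finset.sum_eq_sum_iff_of_le fun i _ => hle i).1 (ha.2.trans (hmaps ha).2.symm) i
    (Finset.mem_univ i)).symm

end Brouwer

/-! ### Weakly sequentially continuous maps have fixed points -/

section ApproximateFixedPoint

variable {F G : Type*} [AddCommGroup F] [Module ℝ F] [TopologicalSpace F] [ContinuousAdd F]
  [ContinuousSMul ℝ F] [NormedAddCommGroup G] [NormedSpace ℝ G]

/-- A self-map `T` of a convex set `K` has points that a linear map `A` with totally bounded image
`A '' K` almost does not distinguish from their images, as soon as `A ∘ T` is continuous: apply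
Brouwer's theorem to the barycentric coordinates with respect to a finite net of `A '' K`. -/
theorem exists_norm_map_sub_map_le (A : F →ₗ[ℝ] G) {K : Set F} (hne : K.Nonempty)
    (hconv : Convex ℝ K) (hA : TotallyBounded (A '' K)) {T : F → F} (hmaps : Set.MapsTo T K K)
    (hT : ContinuousOn (fun x => A (T x)) K) {ε : ℝ} (hε : 0 < ε) :
    ∃ x ∈ K, ‖A x - A (T x)‖ ≤ ε := by
  obtain ⟨t, htK, htfin, hcover⟩ := Metric.finite_approx_of_totallyBounded hA ε hε
  have : Fintype t := htfin.fintype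
  have hnet : ∀ x ∈ K, ∃ i : t, ‖A x - i‖ < ε := fun x hx => by
    obtain ⟨i, hi, hxi⟩ := Set.mem_iUnion₂.1 (hcover ⟨x, hx, rfl⟩)
    exact ⟨⟨i, hi⟩, by simpa [dist_eq_norm] using hxi⟩
  have : Nonempty t := (hnet _ hne.some_mem).nonempty
  have hlift : ∀ i : t, ∃ x ∈ K, A x = i := fun i => htK i.2
  choose p hpK hAp using hlift
  let P : (t → ℝ) → F := fun l => ∑ i, l i • p i
  have hP : Continuous P := continuous_finsetSum _ fun i _ => by fun_prop
  have hPK : Set.MapsTo P (stdSimplex ℝ t) K := fun l hl =>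
    hconv.sum_mem (fun i _ => hl.1 i) hl.2 fun i _ => hpK i
  -- Unnormalized partition of unity subordinate to the balls of radius `ε` around the net.
  let w : t → G → ℝ := fun i z => max 0 (ε - ‖z - i‖)
  have hw : ∀ i, Continuous (w i) := fun i => by fun_prop
  have hw0 : ∀ i z, 0 ≤ w i z := fun i z => le_max_left _ _
  have hW : ∀ x ∈ K, 0 < ∑ i, w i (A x) := fun x hx => by
    obtain ⟨i, hi⟩ := hnet x hx
    exact Finset.sum_pos' (fun i _ => hw0 i _)
      ⟨i, Finset.mem_univ _, lt_max_of_lt_right (sub_pos.2 hi)⟩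
  have hAT : ContinuousOn (fun l => A (T (P l))) (stdSimplex ℝ t) :=
    hT.comp hP.continuousOn hPK
  let g : (t → ℝ) → t → ℝ := fun l i => w i (A (T (P l))) / ∑ j, w j (A (T (P l)))
  have hg : ContinuousOn g (stdSimplex ℝ t) := continuousOn_pi.2 fun i =>
    ((hw i).comp_continuousOn hAT).div
      (continuousOn_finsetSum _ fun j _ => (hw j).comp_continuousOn hAT)
      fun l hl => (hW _ (hmaps (hPK hl))).ne'
  have hgmaps : Set.MapsTo g (stdSimplex ℝ t) (stdSimplex ℝ t) := fun l hl => by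
    have hpos := hW _ (hmaps (hPK hl))
    refine ⟨fun i => div_nonneg (hw0 _ _) hpos.le, ?_⟩
    simp only [g]
    rw [← Finset.sum_div, div_self hpos.ne']
  obtain ⟨l, hl, hgl⟩ := exists_mem_stdSimplex_apply_eq hg hgmaps
  refine ⟨P l, hPK hl, ?_⟩
  have hsub : A (P l) - A (T (P l)) = ∑ i, l i • ((i : G) - A (T (P l))) := by
    simp only [P, map_sum, map_smul, hAp, smul_sub, Finset.sum_sub_distrib]
    rw [← Finset.sum_smul, hl.2, one_smul]
  rw [hsub]
  calc ‖∑ i, l i • ((i : G) - A (T (P l)))‖ ≤ ∑ i, l i * ε := by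
        refine norm_sum_le_of_le _ fun i _ => ?_
        rw [norm_smul, Real.norm_of_nonneg (hl.1 i)]
        -- A positive coordinate means that `A (T (P l))` is within `ε` of the net point.
        rcases (hl.1 i).eq_or_lt with h0 | h0
        · rw [← h0]; simp
        · refine mul_le_mul_of_nonneg_left ?_ h0.le
          have hwi : 0 < w i (A (T (P l))) := by
            rw [← congrFun hgl i] at h0
            exact (div_pos_iff_of_pos_right (hW _ (hmaps (hPK hl)))).1 h0
          rw [norm_sub_rev]
          have := (lt_max_iff.1 hwi).resolve_left (lt_irrefl _)
          linarith
    _ = ε := by rw [← Finset.sum_mul, hl.2, one_mul]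

end ApproximateFixedPoint

section WeakTopology

variable {𝕜 F : Type*} [RCLike 𝕜] [NormedAddCommGroup F] [NormedSpace 𝕜 F]

theorem tendsto_toWeakSpace_iff {α : Type*} {l : Filter α} {u : α → F} {x : F} :
    Tendsto (fun s => toWeakSpace 𝕜 F (u s)) l (𝓝 (toWeakSpace 𝕜 F x)) ↔
      ∀ f : StrongDual 𝕜 F, Tendsto (fun s => f (u s)) l (𝓝 (f x)) :=
  WeakBilin.tendsto_iff_forall_eval_tendsto (topDualPairing 𝕜 F).flip fun x y h => by
    by_contra hne
    obtain ⟨f, hf⟩ := SeparatingDual.exists_separating_of_ne (R := 𝕜) hne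
    exact hf (DFunLike.congr_fun h f)

theorem continuous_strongDual_toWeakSpace_symm (f : StrongDual 𝕜 F) :
    Continuous fun x : WeakSpace 𝕜 F => f ((toWeakSpace 𝕜 F).symm x) :=
  WeakBilin.eval_continuous (topDualPairing 𝕜 F).flip f

theorem tendsto_toWeakSpace {α : Type*} {l : Filter α} {u : α → F} {x : F}
    (h : Tendsto u l (𝓝 x)) :
    Tendsto (fun s => toWeakSpace 𝕜 F (u s)) l (𝓝 (toWeakSpace 𝕜 F x)) :=
  tendsto_toWeakSpace_iff.2 fun f => (f.continuous.tendsto x).comp h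

/-- Closed balls of a reflexive space are weakly compact. -/
theorem IsReflexiveSpace.isCompact_toWeakSpace_closedBall (hF : IsReflexiveSpace 𝕜 F) (ρ : ℝ) :
    IsCompact (toWeakSpace 𝕜 F '' Metric.closedBall 0 ρ) := by
  have hsurj : Function.Surjective (NormedSpace.inclusionInDoubleDualWeak 𝕜 F) := hF
  have hpre : toWeakSpace 𝕜 F '' Metric.closedBall 0 ρ =
      NormedSpace.inclusionInDoubleDualWeak 𝕜 F ⁻¹'
        (WeakDual.toStrongDual ⁻¹' Metric.closedBall 0 ρ) := by
    ext x
    obtain ⟨x, rfl⟩ := (toWeakSpace 𝕜 F).surjective x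
    rw [Function.Injective.mem_set_image (toWeakSpace 𝕜 F).injective]
    change x ∈ Metric.closedBall (0 : F) ρ ↔
      NormedSpace.inclusionInDoubleDual 𝕜 F x ∈
        Metric.closedBall (0 : StrongDual 𝕜 (StrongDual 𝕜 F)) ρ
    have hnorm : ‖NormedSpace.inclusionInDoubleDual 𝕜 F x‖ = ‖x‖ :=
      (NormedSpace.inclusionInDoubleDualLi 𝕜 (E := F)).norm_map x
    exact mem_closedBall_zero_iff.trans
      (Iff.trans (by rw [hnorm]) (mem_closedBall_zero_iff
        (a := NormedSpace.inclusionInDoubleDual 𝕜 F x)).symm)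
  rw [hpre]
  exact (NormedSpace.isEmbedding_inclusionInDoubleDualWeak 𝕜 F).isCompact_preimage'
    (WeakDual.isCompact_closedBall 0 ρ) fun x _ => hsurj x

/-- Countably many functionals suffice to detect the nonzero elements of a separable set:
take norming functionals of the points of a countable dense subset. -/
theorem TopologicalSpace.IsSeparable.exists_seq_strongDual {S : Set F}
    (hS : TopologicalSpace.IsSeparable S) :
    ∃ f : ℕ → StrongDual 𝕜 F, ∀ x ∈ S, (∀ k, f k x = 0) → x = 0 := by
  obtain ⟨D, hD, hSD⟩ := hS
  rcases D.eq_empty_or_nonempty with rfl | hne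
  · exact ⟨0, fun x hx => by simp at hSD; simp [hSD] at hx⟩
  obtain ⟨d, rfl⟩ := hD.exists_eq_range hne
  choose f hf1 hfd using fun k => exists_dual_vector'' 𝕜 (d k)
  refine ⟨f, fun x hx h0 => norm_le_zero_iff.1 (le_of_forall_pos_le_add fun ε hε => ?_)⟩
  obtain ⟨_, ⟨k, rfl⟩, hk⟩ := Metric.mem_closure_iff.1 (hSD hx) (ε / 2) (half_pos hε)
  rw [dist_eq_norm] at hk
  have h1 : ‖d k‖ ≤ ‖x - d k‖ := by
    calc ‖d k‖ = ‖f k (d k - x)‖ := by rw [map_sub, h0, sub_zero, hfd]; simp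
      _ ≤ 1 * ‖d k - x‖ := (f k).le_of_opNorm_le (hf1 k) _
      _ = ‖x - d k‖ := by rw [one_mul, norm_sub_rev]
  have h2 : ‖x‖ ≤ ‖x - d k‖ + ‖d k‖ := by simpa using norm_add_le (x - d k) (d k)
  linarith

theorem isSeqCompact_toWeakSpace_of_isSeparable {K : Set F}
    (hK : IsCompact (toWeakSpace 𝕜 F '' K)) (hsep : TopologicalSpace.IsSeparable K) :
    IsSeqCompact (toWeakSpace 𝕜 F '' K) := by
  obtain ⟨f, hf⟩ := (hsep.span (R := 𝕜)).exists_seq_strongDual (𝕜 := 𝕜)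
  have : CompactSpace (toWeakSpace 𝕜 F '' K) := isCompact_iff_compactSpace.1 hK
  have : TopologicalSpace.MetrizableSpace (toWeakSpace 𝕜 F '' K) :=
    Metric.PiNatEmbed.TopologicalSpace.MetrizableSpace.of_countable_separating
      (fun k x => f k ((toWeakSpace 𝕜 F).symm x))
      (fun k => (continuous_strongDual_toWeakSpace_symm (f k)).comp continuous_subtype_val) (by
        rintro ⟨_, x, hx, rfl⟩ ⟨_, y, hy, rfl⟩ hxy
        by_contra! hcon
        refine hxy (Subtype.ext (congrArg (toWeakSpace 𝕜 F) (sub_eq_zero.1 (hf _ (Submodule.sub_mem _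
          (Submodule.subset_span hx) (Submodule.subset_span hy)) fun k => ?_))))
        rw [map_sub, sub_eq_zero]
        simpa using hcon k)
  have hval : SeqContinuous (fun x : toWeakSpace 𝕜 F '' K => (x : WeakSpace 𝕜 F)) :=
    continuous_iff_seqContinuous.1 continuous_subtype_val
  have hrange := IsSeqCompact.range hval
  rwa [Subtype.range_coe] at hrange

variable [NormedSpace ℝ F] [IsScalarTower ℝ 𝕜 F]

theorem Convex.mem_of_tendsto_toWeakSpace {K : Set F} (hconv : Convex ℝ K) (hclosed : IsClosed K)
    {u : ℕ → F} {x : F} (hu : ∀ s, u s ∈ K)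
    (h : Tendsto (fun s => toWeakSpace 𝕜 F (u s)) atTop (𝓝 (toWeakSpace 𝕜 F x))) : x ∈ K := by
  have hmem := mem_closure_of_tendsto h (Eventually.of_forall fun s => Set.mem_image_of_mem _ (hu s))
  rwa [← hconv.toWeakSpace_closure 𝕜, hclosed.closure_eq,
    (toWeakSpace 𝕜 F).injective.mem_set_image] at hmem

/-- A self-map of a closed convex set that carries norm convergence to weak convergence leaves
invariant some separable closed convex subset: close a point up under adding the images of countable
dense subsets of convex hulls. -/
theorem exists_isSeparable_mapsTo {K : Set F} (hne : K.Nonempty) (hconv : Convex ℝ K)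
    (hclosed : IsClosed K) {T : F → F} (hmaps : Set.MapsTo T K K)
    (hT : ∀ u : ℕ → F, (∀ s, u s ∈ K) → ∀ x ∈ K, Tendsto u atTop (𝓝 x) →
      Tendsto (fun s => toWeakSpace 𝕜 F (T (u s))) atTop (𝓝 (toWeakSpace 𝕜 F (T x)))) :
    ∃ L ⊆ K, L.Nonempty ∧ Convex ℝ L ∧ IsClosed L ∧ TopologicalSpace.IsSeparable L ∧
      Set.MapsTo T L L := by
  -- `D` is chosen for all `C`, with content only for countable ones, so that it can be iterated.
  have hdense : ∀ C : Set F, ∃ D ⊆ convexHull ℝ C, C.Countable →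
      D.Countable ∧ convexHull ℝ C ⊆ closure D := fun C => by
    by_cases hC : C.Countable
    · obtain ⟨D, hDC, hD, hCD⟩ := ((hC.isSeparable.span (R := ℝ)).mono
        (convexHull_min Submodule.subset_span (Submodule.span ℝ C).convex)).exists_countable_dense_subset
      exact ⟨D, hDC, fun _ => ⟨hD, hCD⟩⟩
    · exact ⟨∅, Set.empty_subset _, fun h => absurd h hC⟩
  choose D hDsub hD using hdense
  obtain ⟨x₀, hx₀⟩ := hne
  let C : ℕ → Set F := fun n => Nat.rec {x₀} (fun _ C => C ∪ T '' D C) n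
  have hCsucc : ∀ n, C (n + 1) = C n ∪ T '' D (C n) := fun n => rfl
  have hCcount : ∀ n, (C n).Countable := fun n => by
    induction n with
    | zero => exact Set.countable_singleton x₀
    | succ n ih => exact ih.union (((hD _ ih).1).image T)
  have hCK : ∀ n, C n ⊆ K := fun n => by
    induction n with
    | zero => exact Set.singleton_subset_iff.2 hx₀
    | succ n ih =>
      refine Set.union_subset ih ?_
      rintro _ ⟨x, hx, rfl⟩
      exact hmaps (convexHull_min ih hconv (hDsub _ hx))
  have hCmono : Monotone C := monotone_nat_of_le_succ fun n => Set.subset_union_left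
  have hhullmono : Monotone fun n => convexHull ℝ (C n) := fun m n h =>
    convexHull_mono (hCmono h)
  set U := ⋃ n, convexHull ℝ (C n) with hU
  have hUconv : Convex ℝ U := (hhullmono.directed_le).convex_iUnion fun n => convex_convexHull ℝ _
  have hUK : U ⊆ K := Set.iUnion_subset fun n => convexHull_min (hCK n) hconv
  have hLK : closure U ⊆ K := closure_minimal hUK hclosed
  have hUdense : U ⊆ closure (⋃ n, D (C n)) := Set.iUnion_subset fun n =>
    ((hD _ (hCcount n)).2).trans (closure_mono (Set.subset_iUnion (fun n => D (C n)) n))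
  refine ⟨closure U, hLK, ⟨x₀, subset_closure (Set.mem_iUnion.2
    ⟨0, subset_convexHull ℝ _ (Set.mem_singleton x₀)⟩)⟩, hUconv.closure, isClosed_closure,
    ⟨⋃ n, D (C n), Set.countable_iUnion fun n => (hD _ (hCcount n)).1,
      closure_minimal hUdense isClosed_closure⟩, fun x hx => ?_⟩
  obtain ⟨u, hu, hux⟩ := mem_closure_iff_seq_limit.1
    (closure_minimal hUdense isClosed_closure hx)
  have huT : ∀ s, u s ∈ K ∧ T (u s) ∈ closure U := fun s => by
    obtain ⟨n, hn⟩ := Set.mem_iUnion.1 (hu s)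
    exact ⟨hUK (Set.mem_iUnion.2 ⟨n, hDsub _ hn⟩), subset_closure (Set.mem_iUnion.2
      ⟨n + 1, subset_convexHull ℝ _ (Or.inr (Set.mem_image_of_mem T hn))⟩)⟩
  exact hUconv.closure.mem_of_tendsto_toWeakSpace isClosed_closure (fun s => (huT s).2)
    (hT u (fun s => (huT s).1) x (hLK hx) hux)

/-- A weakly sequentially continuous self-map of a nonempty weakly compact convex set has a fixed
point. -/
theorem exists_fixed_point_of_weakly_seqContinuous {K : Set F} (hne : K.Nonempty)
    (hconv : Convex ℝ K) (hK : IsCompact (toWeakSpace 𝕜 F '' K)) {T : F → F}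
    (hmaps : Set.MapsTo T K K)
    (hT : ∀ u : ℕ → F, (∀ s, u s ∈ K) → ∀ x ∈ K,
      Tendsto (fun s => toWeakSpace 𝕜 F (u s)) atTop (𝓝 (toWeakSpace 𝕜 F x)) →
      Tendsto (fun s => toWeakSpace 𝕜 F (T (u s))) atTop (𝓝 (toWeakSpace 𝕜 F (T x)))) :
    ∃ x ∈ K, T x = x := by
  have hclosed : ∀ L : Set F, IsClosed (toWeakSpace 𝕜 F '' L) → IsClosed L := fun L hL => by
    rw [← Set.preimage_image_eq L (toWeakSpace 𝕜 F).injective]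
    exact hL.preimage (toWeakSpaceCLM 𝕜 F).continuous
  obtain ⟨L, hLK, hLne, hLconv, hLclosed, hLsep, hLmaps⟩ :=
    exists_isSeparable_mapsTo (𝕜 := 𝕜) hne hconv (hclosed K hK.isClosed) hmaps
      fun u hu x hx hux => hT u hu x hx (tendsto_toWeakSpace hux)
  have hLcomp : IsCompact (toWeakSpace 𝕜 F '' L) := hK.of_isClosed_subset (by
    rw [← hLclosed.closure_eq, hLconv.toWeakSpace_closure 𝕜]
    exact isClosed_closure) (Set.image_mono hLK)
  obtain ⟨f, hf⟩ := (hLsep.span (R := 𝕜)).exists_seq_strongDual (𝕜 := 𝕜)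
  have happrox : ∀ n : ℕ, ∃ x ∈ L, ∀ k ≤ n, ‖f k x - f k (T x)‖ ≤ 1 / ((n : ℝ) + 1) := fun n => by
    let A : F →ₗ[ℝ] (Fin (n + 1) → 𝕜) :=
      LinearMap.pi fun k => ((f k : F →L[𝕜] 𝕜) : F →ₗ[𝕜] 𝕜).restrictScalars ℝ
    have hAbdd : TotallyBounded (A '' L) := by
      have himg := (hLcomp.image (f := fun x (k : Fin (n + 1)) => f k ((toWeakSpace 𝕜 F).symm x))
        (continuous_pi fun k => continuous_strongDual_toWeakSpace_symm (f k))).totallyBounded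
      rw [Set.image_image] at himg
      exact himg
    have hAT : ContinuousOn (fun x => A (T x)) L := by
      rw [continuousOn_iff_continuous_domRestrict]
      refine SeqContinuous.continuous fun u x hux => tendsto_pi_nhds.2 fun k => ?_
      exact tendsto_toWeakSpace_iff.1 (hT (fun s => u s) (fun s => hLK (u s).2) x (hLK x.2)
        (tendsto_toWeakSpace ((continuous_subtype_val.tendsto x).comp hux))) (f k)
    obtain ⟨x, hx, hle⟩ := exists_norm_map_sub_map_le A hLne hLconv hAbdd hLmaps hAT
      (Nat.one_div_pos_of_nat (n := n))
    exact ⟨x, hx, fun k hk => (norm_le_pi_norm (A x - A (T x)) ⟨k, Nat.lt_succ_of_le hk⟩).trans hle⟩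
  choose u huL hu using happrox
  obtain ⟨_, ⟨x, hx, rfl⟩, φ, hφ, hlim⟩ := isSeqCompact_toWeakSpace_of_isSeparable hLcomp hLsep
    fun n => Set.mem_image_of_mem (toWeakSpace 𝕜 F) (huL n)
  have hTlim := hT (fun n => u (φ n)) (fun n => hLK (huL _)) x (hLK hx) hlim
  refine ⟨x, hLK hx, (sub_eq_zero.1 (hf _ (Submodule.sub_mem _ (Submodule.subset_span hx)
    (Submodule.subset_span (hLmaps hx))) fun k => ?_)).symm⟩
  have h1 : Tendsto (fun n => f k (u (φ n)) - f k (T (u (φ n)))) atTop (𝓝 (f k x - f k (T x))) :=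
    (tendsto_toWeakSpace_iff.1 hlim (f k)).sub (tendsto_toWeakSpace_iff.1 hTlim (f k))
  have h2 : Tendsto (fun n => f k (u (φ n)) - f k (T (u (φ n)))) atTop (𝓝 0) :=
    squeeze_zero_norm' ((eventually_ge_atTop k).mono fun n hn =>
      hu (φ n) k (hn.trans (hφ.id_le n)))
      (tendsto_one_div_add_atTop_nhds_zero_nat.comp hφ.tendsto_atTop)
  rw [map_sub]
  exact tendsto_nhds_unique h1 h2

end WeakTopology

/-! ### The local surjection theorem -/

theorem lemma2p4 {𝕜 E F : Type*} [RCLike 𝕜]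
    [NormedAddCommGroup E] [NormedSpace 𝕜 E] [CompleteSpace E]
    [NormedAddCommGroup F] [NormedSpace 𝕜 F] [CompleteSpace F]
    (hF : IsReflexiveSpace 𝕜 F)
    (ι : F →ₗ[𝕜] E) (hι : Function.Injective ι)
    (c : ℝ) (hc : 0 < c) (hbound : ∀ w : F, ‖ι w‖ ≤ c * ‖w‖)
    (r : ℝ) (hr : 0 < r) (Φ : E → E)
    (ha1 : ∃ R : E → F, (∀ v ∈ Metric.ball (0 : E) r, ι (R v) = Φ v - v) ∧
      R =o[𝓝 (0 : E)] (fun v : E => v))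
    (ha2 : ∀ v ∈ Metric.ball (0 : E) r, ∀ vs : ℕ → E, (∀ s, vs s ∈ Metric.ball (0 : E) r) →
      TendstoZeroWeaklyIn ι (fun s => vs s - v) →
      TendstoZeroWeaklyIn ι (fun s => Φ (vs s) - Φ v)) :
    ∃ δ : ℝ, 0 < δ ∧ Metric.ball (0 : E) δ ⊆ Φ '' Metric.ball (0 : E) r := by
  let _ : NormedSpace ℝ F := NormedSpace.restrictScalars ℝ 𝕜 F
  have : IsScalarTower ℝ 𝕜 F := RestrictScalars.isScalarTower ℝ 𝕜 F
  obtain ⟨R, hR, hRo⟩ := ha1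
  have hc1 : 0 < 1 + c := by linarith
  obtain ⟨η, hη, hRη⟩ := Metric.eventually_nhds_iff_ball.1 (hRo.bound (inv_pos.2 hc1))
  -- For `‖y‖ < ρ` and `‖w‖ ≤ ρ` the point `y + ι w` has norm less than `(1 + c) * ρ = min η r`.
  set ρ := min η r / (1 + c) with hρdef
  have hρ : 0 < ρ := div_pos (lt_min hη hr) hc1
  have hρmul : (1 + c) * ρ = min η r := mul_div_cancel₀ _ hc1.ne'
  refine ⟨ρ, hρ, fun y hy => ?_⟩
  have hnorm : ∀ w ∈ Metric.closedBall (0 : F) ρ, ‖y + ι w‖ < (1 + c) * ρ := fun w hw => by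
    have h1 : c * ‖w‖ ≤ c * ρ := mul_le_mul_of_nonneg_left (mem_closedBall_zero_iff.1 hw) hc.le
    have h2 := mem_ball_zero_iff.1 hy
    linarith [norm_add_le y (ι w), hbound w]
  have hball : ∀ w ∈ Metric.closedBall (0 : F) ρ, y + ι w ∈ Metric.ball (0 : E) r := fun w hw =>
    mem_ball_zero_iff.2 ((hnorm w hw).trans_le (hρmul.trans_le (min_le_right _ _)))
  have hmaps : Set.MapsTo (fun w => -R (y + ι w)) (Metric.closedBall (0 : F) ρ)
      (Metric.closedBall 0 ρ) := fun w hw => by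
    rw [mem_closedBall_zero_iff, norm_neg]
    refine (hRη _ (mem_ball_zero_iff.2
      ((hnorm w hw).trans_le (hρmul.trans_le (min_le_left _ _))))).trans ?_
    rw [inv_mul_le_iff₀ hc1]
    exact (hnorm w hw).le
  obtain ⟨w, hw, hfix⟩ := exists_fixed_point_of_weakly_seqContinuous (𝕜 := 𝕜)
    (Metric.nonempty_closedBall.2 hρ.le) (convex_closedBall (0 : F) ρ)
    (hF.isCompact_toWeakSpace_closedBall ρ) hmaps (by
      intro u hu x hx hux
      rw [tendsto_toWeakSpace_iff] at hux
      obtain ⟨q, hq, hqlim⟩ := ha2 (y + ι x) (hball x hx) (fun s => y + ι (u s))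
        (fun s => hball _ (hu s)) ⟨fun s => u s - x, fun s => by simp, tendsto_toWeakSpace_iff.2
          fun f => by simpa using (hux f).sub_const (f x)⟩
      rw [tendsto_toWeakSpace_iff] at hqlim
      -- `q s` represents `Φ (y + ι (u s)) - Φ (y + ι x)`, that is, the difference of the
      -- arguments plus the difference of the remainders.
      have hqR : ∀ s, -R (y + ι (u s)) = -R (y + ι x) + (u s - x) - q s := fun s => by
        refine hι ?_
        have h1 := hR _ (hball _ (hu s))
        have h2 := hR _ (hball _ hx)
        have h3 := hq s
        simp only [map_neg, map_add, map_sub, h1, h2, h3]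
        abel
      refine tendsto_toWeakSpace_iff.2 fun f => ?_
      simp only [hqR, map_add, map_sub]
      have := (((hux f).sub_const (f x)).const_add (f (-R (y + ι x)))).sub (hqlim f)
      simpa using this)
  refine ⟨y + ι w, hball w hw, ?_⟩
  have h1 := hR _ (hball w hw)
  have h2 : ι w = -ι (R (y + ι w)) := by rw [← map_neg, hfix]
  rw [h1] at h2
  have h3 : Φ (y + ι w) = y + (ι w + (Φ (y + ι w) - (y + ι w))) := by abel
  rw [h3, add_eq_zero_iff_eq_neg.2 h2, add_zero]
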